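/- Let $N\ge 1$ be an integer, let $0<\alpha<2/N$, and let $\mathfrak m\neq 0$ be a positive finite Borel measure on $\mathbb R^N$ with total mass $\|\mathfrak m\|=\mathfrak m(\mathbb R^N)$. For a positive finite Borel measure $\mu$ on $\mathbb R^N$ consider the integral form $$u(t)=e^{t\Delta}\mu+\int_0^t e^{(t-\sigma)\Delta}\big[|u(\sigma)|^\alpha u(\sigma)\big]\,d\sigma \qquad (*)$$ of the nonlinear heat equation $\partial_t u=\Delta u+|u|^\alpha u$ on $\mathbb R^N$ with initial value $\mu$, where $e^{t\Delta}$ is convolution with the Gauss kernel $(4\pi t)^{-N/2}e^{-|x|^2/(4t)}$. Let $T_{\max}(\mu)\in[0,\infty]$ be either one of the following two existence times: (a) the supremum of all $T>0$ for which there is a nonnegative solution on $(0,T)$, that is, a measurable function $u:(0,T)\times\mathbb R^N\to[0,\infty)$ which satisfies $(*)$ almost everywhere; (b) the existence time of the maximal regular solution, that is, the supremum of all $T>0$ for which there is a (not necessarily nonnegative) $u\in C((0,T];L^{\alpha+1}(\mathbb R^N))$ with $\sup_{0<t\le T}t^{\beta}\|u(t)\|_{L^{\alpha+1}}<\infty$,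 $\beta=\frac N2\big(1-\frac1{\alpha+1}\big)$, which satisfies $(*)$ for all $t\in(0,T]$. In both cases the supremum of the empty set is $0$. Then, for each of the two choices, $T_{\max}(\lambda\mathfrak m)<\infty$ for all $\lambda>0$, and $$\limsup_{\lambda\to0^+}\lambda^{\left(\frac1\alpha-\frac N2\right)^{-1}}T_{\max}(\lambda\mathfrak m)\le\frac1{\left(\alpha^{1/\alpha}(4\pi)^{-N/2}\|\mathfrak m\|\right)^{\left(\frac1\alpha-\frac N2\right)^{-1}}}.$$ -/

import Mathlib

open MeasureTheory Filter Topology Set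
open scoped ENNReal NNReal

noncomputable section

namespace NonlinearHeat

/-- The Gauss kernel `(4πt)^{-N/2} exp(-|z|²/(4t))` of the heat semigroup on `ℝ^N`. -/
def heatKernel {N : ℕ} (t : ℝ) (z : EuclideanSpace ℝ (Fin N)) : ℝ :=
  (4 * Real.pi * t) ^ (-((N : ℝ) / 2)) * Real.exp (-(‖z‖ ^ 2) / (4 * t))

/-- A nonnegative solution on `(0,T) × ℝ^N` of the integral equation
`u(t) = e^{tΔ} μ + ∫_0^t e^{(t-σ)Δ} [|u(σ)|^α u(σ)] dσ`, where `μ` is a positive Borel measure: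
a measurable function with finite nonnegative values that satisfies the equation
at almost every point `(t,x)` of `(0,T) × ℝ^N`. All integrands are nonnegative, so
all integrals are taken in `[0,∞]`. -/
structure IsNonnegSolution {N : ℕ} (α : ℝ) (μ : Measure (EuclideanSpace ℝ (Fin N))) (T : ℝ)
    (u : ℝ → EuclideanSpace ℝ (Fin N) → ℝ≥0) : Prop where
  aemeasurable : AEMeasurable (fun p : ℝ × EuclideanSpace ℝ (Fin N) => u p.1 p.2)
    (volume.restrict (Ioo (0 : ℝ) T ×ˢ univ))
  equation : ∀ᵐ p : ℝ × EuclideanSpace ℝ (Fin N) ∂(volume.restrict (Ioo (0 : ℝ) T ×ˢ univ)),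
    (u p.1 p.2 : ℝ≥0∞) =
      (∫⁻ y, ENNReal.ofReal (heatKernel p.1 (p.2 - y)) ∂μ) +
        ∫⁻ σ in Ioo (0 : ℝ) p.1, ∫⁻ y,
          ENNReal.ofReal (heatKernel (p.1 - σ) (p.2 - y)) * (u σ y : ℝ≥0∞) ^ (α + 1)

/-- The maximal existence time in `[0,∞]` of a nonnegative solution with initial value `μ`
(it is `0` if there is no local solution, and `∞` if there is a global one). -/
def TmaxNonneg {N : ℕ} (α : ℝ) (μ : Measure (EuclideanSpace ℝ (Fin N))) : ℝ≥0∞ :=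
  ⨆ (T : ℝ) (_ : 0 < T) (_ : ∃ u, IsNonnegSolution α μ T u), ENNReal.ofReal T

/-- A regular solution on `(0,T]`, without any condition on its sign, of the integral equation
`u(t) = e^{tΔ} μ + ∫_0^t e^{(t-σ)Δ} [|u(σ)|^α u(σ)] dσ`, for a finite Borel measure `μ`.
It belongs to the class in which the equation is well-posed for measures when `α < 2/N`:
`u ∈ C((0,T]; L^{α+1}(ℝ^N))` and `sup_{0<t≤T} t^β ‖u(t)‖_{α+1} < ∞`,
`β = (N/2)(1 - 1/(α+1))`. Continuity in `L^{α+1}` makes it no restriction to use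
a representative that is measurable in `(t,x)`. -/
structure IsRegularSolution {N : ℕ} (α : ℝ) (μ : Measure (EuclideanSpace ℝ (Fin N))) (T : ℝ)
    (u : ℝ → EuclideanSpace ℝ (Fin N) → ℝ) : Prop where
  aemeasurable : AEMeasurable (fun p : ℝ × EuclideanSpace ℝ (Fin N) => u p.1 p.2)
    (volume.restrict (Ioc (0 : ℝ) T ×ˢ univ))
  memLp : ∀ t ∈ Ioc (0 : ℝ) T, MemLp (u t) (ENNReal.ofReal (α + 1)) volume
  continuous : ∀ t ∈ Ioc (0 : ℝ) T,
    Tendsto (fun s => eLpNorm (u s - u t) (ENNReal.ofReal (α + 1)) volume)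
      (𝓝[Ioc (0 : ℝ) T] t) (𝓝 0)
  bounded : ∃ M : ℝ, ∀ t ∈ Ioc (0 : ℝ) T,
    ENNReal.ofReal (t ^ ((N : ℝ) / 2 * (1 - 1 / (α + 1)))) *
      eLpNorm (u t) (ENNReal.ofReal (α + 1)) volume ≤ ENNReal.ofReal M
  equation : ∀ t ∈ Ioc (0 : ℝ) T, ∀ᵐ x : EuclideanSpace ℝ (Fin N),
    u t x = (∫ y, heatKernel t (x - y) ∂μ) +
      ∫ σ in Ioo (0 : ℝ) t, ∫ y, heatKernel (t - σ) (x - y) * (|u σ y| ^ α * u σ y)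

/-- The existence time in `[0,∞]` of the maximal regular solution with initial value `μ`. -/
def TmaxRegular {N : ℕ} (α : ℝ) (μ : Measure (EuclideanSpace ℝ (Fin N))) : ℝ≥0∞ :=
  ⨆ (T : ℝ) (_ : 0 < T) (_ : ∃ u, IsRegularSolution α μ T u), ENNReal.ofReal T

end NonlinearHeat

end

/-! Fix `(t, x)`, put `A = e^{tΔ}μ(x)` and `φ(s) = e^{(t-s)Δ}[u(s)^(α+1)](x)`. Applying `e^{(t-s)Δ}`
to the equation at time `s` gives `e^{(t-s)Δ}u(s)(x) = A + ∫₀ˢ φ`. The kernel has mass one, so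
Jensen yields `φ(s) ≥ (A + ∫₀ˢ φ)^(α+1)`. Comparison with the blow-up of `k' = k^(α+1)`, `k(0) = A`,
forces `(α t)^(1/α) e^{tΔ}μ ≤ 1` as long as a nonnegative solution exists
(`heat_le_of_supersolution`).

For `μ = λm` this reads `λ t^γ (4π)^(-N/2) ∫ exp(-|x-y|²/(4t)) dm(y) ≤ α^(-1/α)` with `γ = 1/α - N/2
> 0`. The Gaussian integral tends to the total mass as `t → ∞`, so `t` stays bounded for fixed `λ`.
Taking `t = R λ^(-1/γ)` and letting `λ → 0` gives the constant (`mul_gaussianMass_le`,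
`lifeSpan_asymptotics`).

A regular solution has no prescribed sign. Only the Duhamel term of its negative part can push it
below zero, so `W(t) = ∫ (u⁻)^(α+1)` satisfies a closed singular integral inequality by
`L^1`-`L^(α+1)` smoothing (`lintegral_duhamel_rpow_le`). Since `Nα/2 < 1`, a Gronwall argument gives
`W = 0` (`eq_zero_of_singular_inequality`), and the nonnegative case applies. -/

namespace NonlinearHeat

/-! ### Jensen's inequality and the Gauss kernel. -/

section Kernel

variable {N : ℕ}

local notation "E" => EuclideanSpace ℝ (Fin N)

/-- Weighted Jensen inequality: `(∫ k f)^p ≤ (∫ k)^(p-1) ∫ k f^p`. -/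
lemma lintegral_mul_rpow_le {X : Type*} [MeasurableSpace X] {ν : Measure X} {p : ℝ} (hp : 1 ≤ p)
    {k f : X → ℝ≥0∞} (hk : Measurable k) (hf : Measurable f) :
    (∫⁻ x, k x * f x ∂ν) ^ p ≤ (∫⁻ x, k x ∂ν) ^ (p - 1) * ∫⁻ x, k x * f x ^ p ∂ν := by
  have hp0 : 0 < p := by linarith
  -- This is the comparison of the `L^1` and `L^p` norms for the finite or infinite measure `k dν`,
  -- whose total mass is `∫ k`.
  have h := eLpNorm'_le_eLpNorm'_mul_rpow_measure_univ (μ := ν.withDensity k) (p := 1) (q := p)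
    one_pos hp hf.aestronglyMeasurable
  simp only [eLpNorm', enorm_eq_self, ENNReal.rpow_one, div_one, withDensity_apply _ .univ,
    Measure.restrict_univ] at h
  rw [lintegral_withDensity_eq_lintegral_mul _ hk hf,
    lintegral_withDensity_eq_lintegral_mul _ hk (hf.pow_const p)] at h
  have h2 := ENNReal.rpow_le_rpow h hp0.le
  rw [ENNReal.mul_rpow_of_nonneg _ _ hp0.le, ← ENNReal.rpow_mul, ← ENNReal.rpow_mul,
    one_div_mul_cancel hp0.ne', ENNReal.rpow_one, mul_comm] at h2
  have e : (1 - 1 / p) * p = p - 1 := by field_simp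
  rw [e] at h2
  simpa [mul_comm] using h2

lemma measurable_heatKernel : Measurable fun q : ℝ × E => heatKernel q.1 q.2 := by
  unfold heatKernel
  fun_prop

lemma measurable_heatKernel_comp {X : Type*} [MeasurableSpace X] {f : X → ℝ} {g : X → E}
    (hf : Measurable f) (hg : Measurable g) : Measurable fun q => heatKernel (f q) (g q) :=
  measurable_heatKernel.comp (hf.prodMk hg)

lemma heatKernel_nonneg {t : ℝ} (ht : 0 ≤ t) (z : E) : 0 ≤ heatKernel t z := by
  unfold heatKernel
  positivity

lemma heatKernel_le {t : ℝ} (ht : 0 < t) (z : E) :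
    heatKernel t z ≤ (4 * Real.pi * t) ^ (-((N : ℝ) / 2)) := by
  unfold heatKernel
  refine mul_le_of_le_one_right (by positivity) (Real.exp_le_one_iff.2 ?_)
  exact div_nonpos_of_nonpos_of_nonneg (by simp) (by positivity)

lemma lintegral_gaussian {b : ℝ} (hb : 0 < b) :
    ∫⁻ z : E, ENNReal.ofReal (Real.exp (-b * ‖z‖ ^ 2)) =
      ENNReal.ofReal ((Real.pi / b) ^ ((N : ℝ) / 2)) := by
  have h := GaussianFourier.integral_rexp_neg_mul_sq_norm (V := E) hb
  rw [finrank_euclideanSpace_fin] at h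
  rw [← h, ofReal_integral_eq_lintegral_ofReal]
  · refine Integrable.of_integral_ne_zero ?_
    rw [h]
    have := Real.pi_pos
    positivity
  · exact .of_forall fun z => (Real.exp_pos _).le

lemma lintegral_heatKernel {t : ℝ} (ht : 0 < t) :
    ∫⁻ z : E, ENNReal.ofReal (heatKernel t z) = 1 := by
  have hpi := Real.pi_pos
  have e : ∀ z : E, ENNReal.ofReal (heatKernel t z) =
      ENNReal.ofReal ((4 * Real.pi * t) ^ (-((N : ℝ) / 2))) *
        ENNReal.ofReal (Real.exp (-(1 / (4 * t)) * ‖z‖ ^ 2)) := fun z => by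
    rw [heatKernel, ENNReal.ofReal_mul (by positivity)]
    congr 3
    ring
  simp_rw [e]
  rw [lintegral_const_mul _ (by fun_prop), lintegral_gaussian (by positivity),
    ← ENNReal.ofReal_mul (by positivity), ENNReal.ofReal_eq_one]
  have : Real.pi / (1 / (4 * t)) = 4 * Real.pi * t := by field_simp
  rw [this, ← Real.rpow_add (by positivity)]
  simp

lemma lintegral_heatKernel_sub_left {t : ℝ} (ht : 0 < t) (x : E) :
    ∫⁻ y : E, ENNReal.ofReal (heatKernel t (x - y)) = 1 := by
  rw [lintegral_sub_left_eq_self (fun z => ENNReal.ofReal (heatKernel t z)) x,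
    lintegral_heatKernel ht]

lemma lintegral_heatKernel_sub_right {t : ℝ} (ht : 0 < t) (y : E) :
    ∫⁻ x : E, ENNReal.ofReal (heatKernel t (x - y)) = 1 := by
  rw [lintegral_sub_right_eq_self (fun z => ENNReal.ofReal (heatKernel t z)) y,
    lintegral_heatKernel ht]

/-- Completing the square in `y`; this is the exponent identity behind the semigroup law. -/
lemma norm_sq_div_add_norm_sq_div {a b : ℝ} (ha : 0 < a) (hb : 0 < b) (x y : E) :
    ‖x - y‖ ^ 2 / a + ‖y‖ ^ 2 / b =
      ‖x‖ ^ 2 / (a + b) + (a + b) / (a * b) * ‖y - (b / (a + b)) • x‖ ^ 2 := by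
  have h1 := norm_sub_sq_real x y
  have h2 := norm_sub_sq_real y ((b / (a + b)) • x)
  rw [inner_smul_right, norm_smul, mul_pow, Real.norm_eq_abs, sq_abs, real_inner_comm] at h2
  rw [h1, h2]
  field_simp
  ring

/-- The semigroup property of the Gauss kernel. -/
lemma lintegral_heatKernel_mul {a b : ℝ} (ha : 0 < a) (hb : 0 < b) (x z : E) :
    ∫⁻ y : E, ENNReal.ofReal (heatKernel a (x - y)) * ENNReal.ofReal (heatKernel b (y - z)) =
      ENNReal.ofReal (heatKernel (a + b) (x - z)) := by
  have hpi := Real.pi_pos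
  -- After the shift by `z`, the product is the target value times a Gauss kernel in `y` at time
  -- `ab/(a+b)`, which has mass one.
  have key : ∀ y : E, ENNReal.ofReal (heatKernel a (x - (y + z))) *
      ENNReal.ofReal (heatKernel b ((y + z) - z)) =
      ENNReal.ofReal (heatKernel (a + b) (x - z)) *
        ENNReal.ofReal (heatKernel (a * b / (a + b)) (y - (b / (a + b)) • (x - z))) := fun y => by
    rw [← ENNReal.ofReal_mul (heatKernel_nonneg ha.le _),
      ← ENNReal.ofReal_mul (heatKernel_nonneg (by positivity) _)]
    congr 1
    have hx : x - (y + z) = (x - z) - y := by abel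
    rw [hx, add_sub_cancel_right]
    simp only [heatKernel]
    have h := norm_sq_div_add_norm_sq_div ha hb (x - z) y
    rw [mul_mul_mul_comm, mul_mul_mul_comm ((4 * Real.pi * (a + b)) ^ _),
      ← Real.exp_add, ← Real.exp_add,
      ← Real.mul_rpow (by positivity) (by positivity),
      ← Real.mul_rpow (by positivity) (by positivity)]
    congr 2
    · field_simp
    · have e1 : -‖x - z - y‖ ^ 2 / (4 * a) + -‖y‖ ^ 2 / (4 * b) =
          -(‖x - z - y‖ ^ 2 / a + ‖y‖ ^ 2 / b) / 4 := by ring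
      rw [e1, h]
      field_simp
      ring
  rw [← lintegral_add_right_eq_self _ z]
  simp_rw [key]
  rw [lintegral_const_mul _ (measurable_heatKernel_comp (by fun_prop) (by fun_prop)).ennreal_ofReal,
    lintegral_heatKernel_sub_right (by positivity), mul_one]

end Kernel

/-! ### Comparison with the blow-up of an ordinary differential equation. -/

/-- Blow-up of `k' ≥ k^(α+1)`, for a differentiable `k`. -/
lemma mul_le_rpow_neg_of_deriv_ge {α A t : ℝ} (hα : 0 < α) (hA : 0 < A) (ht : 0 < t)
    {k k' : ℝ → ℝ} (h0 : k 0 = A) (hd : ∀ s, HasDerivAt k (k' s) s)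
    (hk : ∀ s ∈ Icc 0 t, A ≤ k s) (hk' : ∀ s ∈ Icc 0 t, k s ^ (α + 1) ≤ k' s) :
    α * t ≤ A ^ (-α) := by
  have hpos : ∀ s ∈ Icc 0 t, 0 < k s := fun s hs => hA.trans_le (hk s hs)
  have hder : ∀ s ∈ Icc 0 t, HasDerivAt (fun s => k s ^ (-α) + α * s)
      (k' s * (-α) * k s ^ (-α - 1) + α * 1) s := fun s hs =>
    ((hd s).rpow_const (Or.inl (hpos s hs).ne')).add ((hasDerivAt_id s).const_mul α)
  -- The differential inequality says `(k^(-α))' ≤ -α`. Comparing the endpoints and dropping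
  -- `k(t)^(-α) ≥ 0` gives the bound.
  have hanti : AntitoneOn (fun s => k s ^ (-α) + α * s) (Icc 0 t) := by
    refine antitoneOn_of_hasDerivWithinAt_nonpos (convex_Icc 0 t)
      (fun s hs => (hder s hs).continuousAt.continuousWithinAt)
      (fun s hs => (hder s (interior_subset hs)).hasDerivWithinAt) fun s hs => ?_
    have hs := interior_subset hs
    have h1 : 1 ≤ k' s * k s ^ (-α - 1) := by
      calc (1 : ℝ) = k s ^ (α + 1) * k s ^ (-α - 1) := by
            rw [← Real.rpow_add (hpos s hs)]
            norm_num
        _ ≤ _ := by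
            gcongr
            · exact Real.rpow_nonneg (hpos s hs).le _
            · exact hk' s hs
    nlinarith
  have h := hanti (left_mem_Icc.2 ht.le) (right_mem_Icc.2 ht.le) ht.le
  simp only [h0, mul_zero, add_zero] at h
  have := Real.rpow_nonneg (hpos t (right_mem_Icc.2 ht.le)).le (-α)
  linarith

/-- If `φ ≥ (A + ∫₀ˢ φ)^(α+1)` for a.e. `s ∈ (0,t)` with `φ` integrable, then
`A ≤ (α t)^(-1/α)`. -/
lemma le_rpow_of_integral_inequality {α t : ℝ} (hα : 0 < α) (ht : 0 < t) {A : ℝ≥0∞} (hA : A ≠ ⊤)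
    {φ : ℝ → ℝ≥0∞} (hφm : Measurable φ) (hφ : ∫⁻ s in Ioo 0 t, φ s ≠ ⊤)
    (h : ∀ᵐ s ∂(volume.restrict (Ioo 0 t)), (A + ∫⁻ σ in Ioo 0 s, φ σ) ^ (α + 1) ≤ φ s) :
    A ≤ ENNReal.ofReal ((α * t) ^ (-(1 / α))) := by
  rcases eq_or_ne A 0 with rfl | hA0
  · simp
  have hAr : 0 < A.toReal := ENNReal.toReal_pos hA0 hA
  -- Truncation outside `(0,t)` makes the function integrable on the whole line, so its primitive is
  -- continuous everywhere.
  set ψ : ℝ → ℝ≥0∞ := (Ioo 0 t).indicator φ with hψ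
  have hψm : Measurable ψ := hφm.indicator measurableSet_Ioo
  have hψi : ∫⁻ s, ψ s ≠ ⊤ := by rwa [hψ, lintegral_indicator measurableSet_Ioo]
  have hint : Integrable fun s => (ψ s).toReal := integrable_toReal_of_lintegral_ne_top
    hψm.aemeasurable hψi
  set H : ℝ → ℝ := fun s => A.toReal + ∫ σ in (0 : ℝ)..s, (ψ σ).toReal with hH
  have hHc : Continuous H := continuous_const.add
    (intervalIntegral.continuous_primitive (fun _ _ => hint.intervalIntegrable) 0)
  have hHeq : ∀ s ∈ Icc 0 t, ENNReal.ofReal (H s) = A + ∫⁻ σ in Ioo 0 s, φ σ := fun s hs => by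
    rw [hH, ENNReal.ofReal_add hAr.le
      (intervalIntegral.integral_nonneg hs.1 fun _ _ => ENNReal.toReal_nonneg),
      ENNReal.ofReal_toReal hA, intervalIntegral.integral_of_le hs.1,
      integral_toReal hψm.aemeasurable.restrict, ENNReal.ofReal_toReal,
      ← setLIntegral_congr Ioo_ae_eq_Ioc]
    · congr 1
      refine setLIntegral_congr_fun measurableSet_Ioo fun σ hσ => ?_
      exact indicator_of_mem (show σ ∈ Ioo 0 t from ⟨hσ.1, hσ.2.trans_le hs.2⟩) φ
    · exact ((setLIntegral_le_lintegral _ _).trans_lt hψi.lt_top).ne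
    · exact ae_restrict_of_ae (ae_lt_top hψm hψi)
  have hHA : ∀ s, 0 ≤ s → A.toReal ≤ H s := fun s hs => le_add_of_nonneg_right
    (intervalIntegral.integral_nonneg hs fun _ _ => ENNReal.toReal_nonneg)
  have hHp : Continuous fun s => H s ^ (α + 1) := hHc.rpow_const fun _ => Or.inr (by linarith)
  -- `H` is only continuous, because `φ` is merely integrable. Integrating once more gives a `C¹`
  -- function with `k ≤ H`, hence `k' = H^(α+1) ≥ k^(α+1)`.
  set k : ℝ → ℝ := fun s => A.toReal + ∫ σ in (0 : ℝ)..s, H σ ^ (α + 1) with hk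
  have hkd : ∀ s, HasDerivAt k (H s ^ (α + 1)) s := fun s =>
    (hHp.integral_hasStrictDerivAt 0 s).hasDerivAt.const_add _
  have hkA : ∀ s ∈ Icc 0 t, A.toReal ≤ k s := fun s hs => le_add_of_nonneg_right
    (intervalIntegral.integral_nonneg hs.1 fun σ hσ =>
      Real.rpow_nonneg (hAr.le.trans (hHA σ hσ.1)) _)
  have hae : ∀ᵐ s, s ∈ Ioo 0 t → H s ^ (α + 1) ≤ (ψ s).toReal := by
    filter_upwards [(ae_restrict_iff' measurableSet_Ioo).1 h, ae_lt_top hψm hψi] with s hs hfin hmem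
    have h1 := hs hmem
    have hs' := Ioo_subset_Icc_self hmem
    rw [← hHeq s hs', ENNReal.ofReal_rpow_of_nonneg (hAr.le.trans (hHA s hmem.1.le))
      (by linarith)] at h1
    have h2 : ψ s = φ s := indicator_of_mem hmem φ
    rw [← h2] at h1
    exact (ENNReal.ofReal_le_iff_le_toReal hfin.ne).1 h1
  have hkH : ∀ s ∈ Icc 0 t, k s ≤ H s := fun s hs => by
    refine add_le_add le_rfl ?_
    rw [intervalIntegral.integral_of_le hs.1, intervalIntegral.integral_of_le hs.1,
      integral_Ioc_eq_integral_Ioo,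
      integral_Ioc_eq_integral_Ioo]
    refine setIntegral_mono_ae_restrict
      ((hHp.integrableOn_Icc (a := 0) (b := s)).mono_set Ioo_subset_Icc_self) hint.integrableOn ?_
    refine (ae_restrict_iff' measurableSet_Ioo).2 ?_
    filter_upwards [hae] with σ hσ hmem
    exact hσ ⟨hmem.1, hmem.2.trans_le hs.2⟩
  have hfin := mul_le_rpow_neg_of_deriv_ge hα hAr ht (by simp [hk]) hkd hkA fun s hs =>
    Real.rpow_le_rpow (hAr.le.trans (hkA s hs)) (hkH s hs) (by linarith)
  rw [← ENNReal.ofReal_toReal hA]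
  refine ENNReal.ofReal_le_ofReal ?_
  have h1 : (A.toReal ^ (-α)) ^ (-(1 / α)) ≤ (α * t) ^ (-(1 / α)) :=
    Real.rpow_le_rpow_of_nonpos (by positivity) hfin (by simp [hα.le])
  rwa [← Real.rpow_mul hAr.le, show -α * -(1 / α) = 1 by field_simp, Real.rpow_one] at h1

/-! ### The pointwise bound on the heat flow for nonnegative solutions. -/

section Supersolution

variable {N : ℕ}

local notation "E" => EuclideanSpace ℝ (Fin N)

/-- The right-hand side of the integral equation for a `[0,∞]`-valued function. -/
noncomputable def duhamel (α : ℝ) (μ : Measure E) (V : ℝ → E → ℝ≥0∞) (t : ℝ) (x : E) : ℝ≥0∞ :=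
  (∫⁻ y, ENNReal.ofReal (heatKernel t (x - y)) ∂μ) +
    ∫⁻ σ in Ioo (0 : ℝ) t, ∫⁻ y, ENNReal.ofReal (heatKernel (t - σ) (x - y)) * V σ y ^ (α + 1)

/-- Applying the heat semigroup to the integral equation. -/
lemma lintegral_heatKernel_mul_duhamel (α : ℝ) (μ : Measure E) [SFinite μ] {V : ℝ → E → ℝ≥0∞}
    (hV : Measurable (Function.uncurry V)) {s t : ℝ} (hs : 0 < s) (hst : s < t) (x : E) :
    ∫⁻ y, ENNReal.ofReal (heatKernel (t - s) (x - y)) * duhamel α μ V s y =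
      (∫⁻ y, ENNReal.ofReal (heatKernel t (x - y)) ∂μ) +
        ∫⁻ σ in Ioo (0 : ℝ) s, ∫⁻ y,
          ENNReal.ofReal (heatKernel (t - σ) (x - y)) * V σ y ^ (α + 1) := by
  have hk : ∀ c : ℝ, Measurable fun y : E => ENNReal.ofReal (heatKernel c (x - y)) := fun c =>
    (measurable_heatKernel_comp (by fun_prop) (by fun_prop)).ennreal_ofReal
  have hV' : Measurable fun q : ℝ × E => V q.1 q.2 ^ (α + 1) := hV.pow_const _
  have hm1 : Measurable fun q : E × E => ENNReal.ofReal (heatKernel s (q.1 - q.2)) :=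
    (measurable_heatKernel_comp (by fun_prop) (by fun_prop)).ennreal_ofReal
  have hm3 : Measurable fun q : (E × ℝ) × E =>
      ENNReal.ofReal (heatKernel (s - q.1.2) (q.1.1 - q.2)) * V q.1.2 q.2 ^ (α + 1) :=
    (measurable_heatKernel_comp (by fun_prop) (by fun_prop)).ennreal_ofReal.mul
      (hV'.comp (f := fun q : (E × ℝ) × E => (q.1.2, q.2)) (by fun_prop))
  have hm2 : Measurable fun q : E × ℝ => ∫⁻ z,
      ENNReal.ofReal (heatKernel (s - q.2) (q.1 - z)) * V q.2 z ^ (α + 1) :=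
    hm3.lintegral_prod_right'
  have hm4 : Measurable fun y : E => ENNReal.ofReal (heatKernel (t - s) (x - y)) *
      ∫⁻ z, ENNReal.ofReal (heatKernel s (y - z)) ∂μ := (hk _).mul hm1.lintegral_prod_right'
  simp only [duhamel, mul_add]
  rw [lintegral_add_left hm4]
  congr 1
  -- In both terms Tonelli brings the two kernels together and the semigroup law merges them: times
  -- `t-s` and `s` add up to `t`, times `t-s` and `s-σ` to `t-σ`.
  · simp_rw [← lintegral_const_mul' _ _ ENNReal.ofReal_ne_top]
    rw [lintegral_lintegral_swap
      (((hk (t - s)).comp measurable_fst).mul hm1).aemeasurable]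
    refine lintegral_congr fun z => ?_
    rw [lintegral_heatKernel_mul (by linarith) hs, sub_add_cancel]
  · simp_rw [← lintegral_const_mul' _ _ ENNReal.ofReal_ne_top]
    rw [lintegral_lintegral_swap (Measurable.aemeasurable ?_)]
    · refine setLIntegral_congr_fun measurableSet_Ioo fun σ hσ => ?_
      rw [lintegral_lintegral_swap (Measurable.aemeasurable ?_)]
      · refine lintegral_congr fun z => ?_
        simp_rw [← mul_assoc]
        rw [lintegral_mul_const, lintegral_heatKernel_mul (by linarith) (by linarith [hσ.2]),
          sub_add_sub_cancel]
        exact (hk _).mul (measurable_heatKernel_comp (by fun_prop) (by fun_prop)).ennreal_ofReal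
      · exact ((hk (t - s)).comp measurable_fst).mul
          (hm3.comp (f := fun q : E × E => ((q.1, σ), q.2)) (by fun_prop))
    · simp_rw [lintegral_const_mul' _ _ ENNReal.ofReal_ne_top]
      exact ((hk (t - s)).comp measurable_fst).mul hm2

/-- A finite supersolution on `(0,T)` forces `(α t)^(1/α) e^{tΔ} μ ≤ 1`. -/
theorem heat_le_of_supersolution {α : ℝ} (hα : 0 < α) (μ : Measure E) [SFinite μ]
    {V : ℝ → E → ℝ≥0∞} (hV : Measurable (Function.uncurry V)) {T : ℝ}
    (h : ∀ᵐ t ∂(volume.restrict (Ioo 0 T)), ∀ᵐ x, duhamel α μ V t x ≤ V t x)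
    (hfin : ∀ᵐ t ∂(volume.restrict (Ioo 0 T)), ∀ᵐ x, V t x < ⊤) :
    ∀ᵐ t ∂(volume.restrict (Ioo 0 T)), ∀ᵐ x,
      ∫⁻ y, ENNReal.ofReal (heatKernel t (x - y)) ∂μ ≤ ENNReal.ofReal ((α * t) ^ (-(1 / α))) := by
  have h' := (ae_restrict_iff' measurableSet_Ioo).1 h
  filter_upwards [h, hfin, ae_restrict_mem measurableSet_Ioo] with t ht ht' htT
  filter_upwards [ht, ht'] with x hx hx'
  -- Finiteness of `V` at this one point makes both `A` and `∫₀ᵗ φ` finite, as the comparison lemma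
  -- requires.
  have hI : duhamel α μ V t x < ⊤ := hx.trans_lt hx'
  rw [duhamel, ENNReal.add_lt_top] at hI
  have hm : Measurable fun q : ℝ × E =>
      ENNReal.ofReal (heatKernel (t - q.1) (x - q.2)) * V q.1 q.2 ^ (α + 1) :=
    (measurable_heatKernel_comp (by fun_prop) (by fun_prop)).ennreal_ofReal.mul (hV.pow_const _)
  refine le_rpow_of_integral_inequality hα htT.1 hI.1.ne hm.lintegral_prod_right' hI.2.ne ?_
  refine (ae_restrict_iff' measurableSet_Ioo).2 ?_
  filter_upwards [h'] with s hs hst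
  have hk : Measurable fun y : E => ENNReal.ofReal (heatKernel (t - s) (x - y)) :=
    (measurable_heatKernel_comp (by fun_prop) (by fun_prop)).ennreal_ofReal
  have hVs : Measurable (V s) := hV.comp (f := fun y => (s, y)) (by fun_prop)
  rw [← lintegral_heatKernel_mul_duhamel α μ hV hst.1 hst.2]
  calc (∫⁻ y, ENNReal.ofReal (heatKernel (t - s) (x - y)) * duhamel α μ V s y) ^ (α + 1)
      ≤ (∫⁻ y, ENNReal.ofReal (heatKernel (t - s) (x - y)) * V s y) ^ (α + 1) := by
        refine ENNReal.rpow_le_rpow (lintegral_mono_ae ?_) (by linarith)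
        filter_upwards [hs ⟨hst.1, hst.2.trans htT.2⟩] with y hy
        gcongr
    _ ≤ _ := by
        refine (lintegral_mul_rpow_le (by linarith) hk hVs).trans_eq ?_
        rw [lintegral_heatKernel_sub_left (by linarith [hst.2]), ENNReal.one_rpow, one_mul]

/-- `duhamel` depends only on the a.e. class of `V`. -/
lemma duhamel_congr {α : ℝ} (μ : Measure E) {V W : ℝ → E → ℝ≥0∞} {T t : ℝ} (htT : t ≤ T)
    (h : ∀ᵐ s ∂(volume.restrict (Ioo 0 T)), V s =ᵐ[volume] W s) (x : E) :
    duhamel α μ V t x = duhamel α μ W t x := by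
  unfold duhamel
  congr 1
  refine lintegral_congr_ae ?_
  filter_upwards [ae_restrict_of_ae_restrict_of_subset (Ioo_subset_Ioo_right htT) h] with s hs
  refine lintegral_congr_ae ?_
  filter_upwards [hs] with y hy
  rw [hy]

lemma ae_ae_of_ae_restrict_prod_univ {s : Set ℝ} {P : ℝ × E → Prop}
    (h : ∀ᵐ q ∂(volume.restrict (s ×ˢ (univ : Set E))), P q) :
    ∀ᵐ t ∂(volume.restrict s), ∀ᵐ x, P (t, x) := by
  rw [Measure.volume_eq_prod, ← Measure.prod_restrict, Measure.restrict_univ] at h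
  exact Measure.ae_ae_of_ae_prod h

/-- A jointly measurable representative is again a solution, because the Duhamel term depends only
on the a.e. class. -/
theorem IsNonnegSolution.heat_le {α : ℝ} (hα : 0 < α) {μ : Measure E} [SFinite μ] {T : ℝ}
    {u : ℝ → E → ℝ≥0} (hu : IsNonnegSolution α μ T u) :
    ∀ᵐ t ∂(volume.restrict (Ioo 0 T)), ∀ᵐ x,
      ∫⁻ y, ENNReal.ofReal (heatKernel t (x - y)) ∂μ ≤ ENNReal.ofReal ((α * t) ^ (-(1 / α))) := by
  set v := hu.aemeasurable.mk with hv
  have huv : ∀ᵐ t ∂(volume.restrict (Ioo 0 T)), ∀ᵐ x, u t x = v (t, x) :=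
    ae_ae_of_ae_restrict_prod_univ hu.aemeasurable.ae_eq_mk
  refine heat_le_of_supersolution hα μ (V := fun t x => (v (t, x) : ℝ≥0∞))
    (measurable_coe_nnreal_ennreal.comp hu.aemeasurable.measurable_mk) ?_
    (.of_forall fun t => .of_forall fun x => ENNReal.coe_lt_top)
  filter_upwards [huv, ae_ae_of_ae_restrict_prod_univ hu.equation,
    ae_restrict_mem measurableSet_Ioo] with t h1 h2 ht
  filter_upwards [h1, h2] with x hx hx'
  rw [← hx, hx', duhamel_congr μ (W := fun t x => (u t x : ℝ≥0∞)) ht.2.le]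
  · rfl
  · filter_upwards [huv] with s hs
    filter_upwards [hs] with y hy
    rw [hy]

end Supersolution

/-! ### Weakly singular integrals and a nonlinear Gronwall inequality. -/

lemma lintegral_Ioo_rpow_neg {θ : ℝ} (hθ : θ < 1) {r : ℝ} (hr : 0 ≤ r) :
    ∫⁻ σ in Ioo 0 r, ENNReal.ofReal (σ ^ (-θ)) = ENNReal.ofReal (r ^ (1 - θ) / (1 - θ)) := by
  have hi : IntervalIntegrable (fun σ : ℝ => σ ^ (-θ)) volume 0 r :=
    intervalIntegral.intervalIntegrable_rpow' (by linarith)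
  have h := integral_rpow (a := 0) (b := r) (r := -θ) (Or.inl (by linarith))
  rw [Real.zero_rpow (by linarith), sub_zero, intervalIntegral.integral_of_le hr,
    integral_Ioc_eq_integral_Ioo] at h
  rw [show 1 - θ = -θ + 1 by ring, ← h, ofReal_integral_eq_lintegral_ofReal]
  · exact (hi.1).mono_set Ioo_subset_Ioc_self
  · filter_upwards [ae_restrict_mem measurableSet_Ioo] with σ hσ
    exact Real.rpow_nonneg hσ.1.le _

lemma lintegral_Ioo_sub_right (f : ℝ → ℝ≥0∞) (τ t : ℝ) :
    ∫⁻ σ in Ioo τ t, f (σ - τ) = ∫⁻ σ in Ioo 0 (t - τ), f σ := by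
  rw [← lintegral_indicator measurableSet_Ioo, ← lintegral_indicator measurableSet_Ioo,
    ← lintegral_sub_right_eq_self ((Ioo 0 (t - τ)).indicator f) τ]
  congr 1 with σ
  simp [indicator, sub_pos]

lemma lintegral_Ioo_sub_left (f : ℝ → ℝ≥0∞) (τ t : ℝ) :
    ∫⁻ σ in Ioo τ t, f (t - σ) = ∫⁻ σ in Ioo 0 (t - τ), f σ := by
  rw [← lintegral_indicator measurableSet_Ioo, ← lintegral_indicator measurableSet_Ioo,
    ← lintegral_sub_left_eq_self _ t]
  congr 1 with σ
  simp [indicator, and_comm, lt_sub_comm]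

/-- Meant for `a = t-σ`, `b = σ`, `c = σ-τ`. The larger of `a` and `b` absorbs `(a+b)^β`, leaving
singularities only at the ends of `(τ,t)`, so that the integral is controlled by `t-τ` alone. -/
lemma rpow_mul_rpow_neg_le {β θ a b c : ℝ} (hβ : 0 ≤ β) (hβθ : β ≤ θ) (hc : 0 < c) (hcb : c ≤ b)
    (ha : 0 < a) :
    (a + b) ^ β * (a ^ (-β) * b ^ (-θ)) ≤ 2 ^ β * (a ^ (-θ) + c ^ (-θ)) := by
  have hb : 0 < b := hc.trans_le hcb
  have hbc : b ^ (-θ) ≤ c ^ (-θ) := Real.rpow_le_rpow_of_nonpos hc hcb (by linarith)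
  have hcθ : 0 < c ^ (-θ) := Real.rpow_pos_of_pos hc _
  have haθ : 0 < a ^ (-θ) := Real.rpow_pos_of_pos ha _
  rcases le_total a b with hab | hab
  · calc (a + b) ^ β * (a ^ (-β) * b ^ (-θ)) ≤ (2 * b) ^ β * (a ^ (-β) * b ^ (-θ)) := by
          gcongr; linarith
      _ = 2 ^ β * (a ^ (-β) * b ^ (β - θ)) := by
          rw [Real.mul_rpow (by norm_num) hb.le, sub_eq_add_neg, Real.rpow_add hb]; ring
      _ ≤ 2 ^ β * (a ^ (-β) * a ^ (β - θ)) := by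
          gcongr 2 ^ β * (_ * ?_)
          exact Real.rpow_le_rpow_of_nonpos ha hab (by linarith)
      _ = 2 ^ β * a ^ (-θ) := by
          rw [← Real.rpow_add ha]; congr 2; ring
      _ ≤ _ := by gcongr; linarith
  · calc (a + b) ^ β * (a ^ (-β) * b ^ (-θ)) ≤ (2 * a) ^ β * (a ^ (-β) * b ^ (-θ)) := by
          gcongr; linarith
      _ = 2 ^ β * b ^ (-θ) := by
          rw [Real.mul_rpow (by norm_num) ha.le, mul_assoc, ← mul_assoc (a ^ β),
            ← Real.rpow_add ha]
          simp
      _ ≤ _ := by gcongr; linarith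

/-- The weakly singular kernel is small on short intervals, uniformly in their position. -/
lemma singular_integral_le {β θ τ t δ : ℝ} (hβ : 0 ≤ β) (hβθ : β ≤ θ) (hθ : θ < 1) (hτ : 0 ≤ τ)
    (hτt : τ ≤ t) (htδ : t ≤ τ + δ) :
    ENNReal.ofReal (t ^ β) * ∫⁻ σ in Ioo τ t,
        ENNReal.ofReal ((t - σ) ^ (-β)) * ENNReal.ofReal (σ ^ (-θ)) ≤
      ENNReal.ofReal (2 ^ β * 2 * (δ ^ (1 - θ) / (1 - θ))) := by
  have h1θ : 0 < 1 - θ := by linarith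
  have hδ : 0 ≤ δ := by linarith
  rw [← lintegral_const_mul' _ _ ENNReal.ofReal_ne_top]
  calc _ ≤ ∫⁻ σ in Ioo τ t, ENNReal.ofReal (2 ^ β) *
        (ENNReal.ofReal ((t - σ) ^ (-θ)) + ENNReal.ofReal ((σ - τ) ^ (-θ))) := by
        refine setLIntegral_mono' measurableSet_Ioo fun σ hσ => ?_
        have h1 : 0 < t - σ := by linarith [hσ.2]
        have h2 : 0 < σ - τ := by linarith [hσ.1]
        rw [← ENNReal.ofReal_mul (by positivity),
          ← ENNReal.ofReal_mul (Real.rpow_nonneg (hτ.trans hτt) _),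
          ← ENNReal.ofReal_add (by positivity) (by positivity),
          ← ENNReal.ofReal_mul (by positivity)]
        refine ENNReal.ofReal_le_ofReal ?_
        have := rpow_mul_rpow_neg_le hβ hβθ h2 (by linarith : σ - τ ≤ σ) h1
        rwa [sub_add_cancel] at this
    _ = ENNReal.ofReal (2 ^ β) * (ENNReal.ofReal ((t - τ) ^ (1 - θ) / (1 - θ)) +
          ENNReal.ofReal ((t - τ) ^ (1 - θ) / (1 - θ))) := by
        rw [lintegral_const_mul' _ _ ENNReal.ofReal_ne_top, lintegral_add_left (by fun_prop),
          lintegral_Ioo_sub_left (fun σ => ENNReal.ofReal (σ ^ (-θ))),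
          lintegral_Ioo_sub_right (fun σ => ENNReal.ofReal (σ ^ (-θ))),
          lintegral_Ioo_rpow_neg hθ (by linarith)]
    _ ≤ ENNReal.ofReal (2 ^ β) * (ENNReal.ofReal (δ ^ (1 - θ) / (1 - θ)) +
          ENNReal.ofReal (δ ^ (1 - θ) / (1 - θ))) := by
        gcongr <;> linarith
    _ = _ := by
        rw [← ENNReal.ofReal_add (by positivity) (by positivity),
          ← ENNReal.ofReal_mul (by positivity)]
        congr 1; ring

/-- A singular Gronwall inequality: `W(t) ≤ C (∫₀ᵗ (t-σ)^(-β) W(σ) dσ)^p` and `W(t) = O(t^(-θ))`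
with `θ = β p < 1` force `W = 0`. -/
theorem eq_zero_of_singular_inequality {p θ T : ℝ} (hp : 1 < p) (hθ0 : 0 < θ) (hθ : θ < 1)
    {W : ℝ → ℝ≥0∞} {C M : ℝ≥0∞} (hC : C ≠ ⊤) (hM : M ≠ ⊤)
    (hWM : ∀ t ∈ Ioc 0 T, ENNReal.ofReal (t ^ θ) * W t ≤ M)
    (hW : ∀ t ∈ Ioc 0 T,
      W t ≤ C * (∫⁻ σ in Ioo 0 t, ENNReal.ofReal ((t - σ) ^ (-(θ / p))) * W σ) ^ p) :
    ∀ t ∈ Ioc 0 T, W t = 0 := by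
  have hp0 : 0 < p := by linarith
  have h1θ : 0 < 1 - θ := by linarith
  -- The step length depends only on `C`, `M`, `p`, `θ` and not on the position `τ`, so finitely
  -- many steps reach any `t ≤ T`.
  obtain ⟨δ, hδ, hδC⟩ : ∃ δ : ℝ, 0 < δ ∧
      C * M ^ (p - 1) * ENNReal.ofReal (2 ^ (θ / p) * 2 * (δ ^ (1 - θ) / (1 - θ))) ^ p < 1 := by
    have hlim : Tendsto (fun δ : ℝ => C * M ^ (p - 1) *
        ENNReal.ofReal (2 ^ (θ / p) * 2 * (δ ^ (1 - θ) / (1 - θ))) ^ p) (𝓝[>] 0) (𝓝 0) := by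
      have h1 : Tendsto (fun δ : ℝ => 2 ^ (θ / p) * 2 * (δ ^ (1 - θ) / (1 - θ))) (𝓝[>] 0)
          (𝓝 0) := by
        have h2 : Tendsto (fun δ : ℝ => δ ^ (1 - θ)) (𝓝[>] 0) (𝓝 (0 ^ (1 - θ))) :=
          ((Real.continuous_rpow_const h1θ.le).tendsto 0).mono_left nhdsWithin_le_nhds
        rw [Real.zero_rpow h1θ.ne'] at h2
        simpa using (h2.div_const (1 - θ)).const_mul (2 ^ (θ / p) * 2)
      have h3 := (ENNReal.continuous_rpow_const (y := p)).tendsto _ |>.comp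
        (ENNReal.tendsto_ofReal h1)
      have h4 := ENNReal.Tendsto.const_mul (a := C * M ^ (p - 1)) h3
        (Or.inr (ENNReal.mul_ne_top hC (ENNReal.rpow_ne_top_of_nonneg (by linarith) hM)))
      simpa [ENNReal.zero_rpow_of_pos hp0] using h4
    obtain ⟨δ, h1, h2⟩ :=
      ((hlim.eventually (gt_mem_nhds one_pos)).and self_mem_nhdsWithin).exists
    exact ⟨δ, h2, h1⟩
  have step : ∀ τ, 0 ≤ τ → (∀ t ∈ Ioc 0 T, t ≤ τ → W t = 0) →
      ∀ t ∈ Ioc 0 T, t ≤ τ + δ → W t = 0 := by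
    intro τ hτ hzero
    set S : ℝ≥0∞ := ⨆ t ∈ Ioc 0 T ∩ Iic (τ + δ), ENNReal.ofReal (t ^ θ) * W t with hS
    have hSM : S ≤ M := iSup₂_le fun t ht => hWM t ht.1
    have hSt : S ≠ ⊤ := (hSM.trans_lt hM.lt_top).ne
    have hWS : ∀ t ∈ Ioc 0 T, t ≤ τ + δ → W t ≤ S * ENNReal.ofReal (t ^ (-θ)) := by
      intro t ht htδ
      have h1 : ENNReal.ofReal (t ^ θ) * W t ≤ S :=
        le_iSup₂ (f := fun t (_ : t ∈ Ioc 0 T ∩ Iic (τ + δ)) => ENNReal.ofReal (t ^ θ) * W t) t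
          ⟨ht, htδ⟩
      calc W t = ENNReal.ofReal (t ^ θ) * W t * ENNReal.ofReal (t ^ (-θ)) := by
            rw [mul_right_comm, ← ENNReal.ofReal_mul (Real.rpow_nonneg ht.1.le _),
              ← Real.rpow_add ht.1]
            simp
        _ ≤ _ := by gcongr
    -- The inequality has degree `p` in `W`. The a priori bound `S ≤ M` linearises it through `S^p ≤
    -- M^(p-1) S`, and the remaining factor is below one by the choice of `δ`.
    have hS' : S ≤ C * M ^ (p - 1) *
        ENNReal.ofReal (2 ^ (θ / p) * 2 * (δ ^ (1 - θ) / (1 - θ))) ^ p * S := by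
      refine iSup₂_le fun t ht => ?_
      rcases le_or_gt t τ with htτ | htτ
      · simp [hzero t ht.1 htτ]
      have hint : ∫⁻ σ in Ioo 0 t, ENNReal.ofReal ((t - σ) ^ (-(θ / p))) * W σ ≤
          S * ∫⁻ σ in Ioo τ t,
            ENNReal.ofReal ((t - σ) ^ (-(θ / p))) * ENNReal.ofReal (σ ^ (-θ)) := by
        rw [← lintegral_const_mul' _ _ hSt, ← lintegral_indicator measurableSet_Ioo (μ := volume),
          ← lintegral_indicator measurableSet_Ioo (μ := volume)]
        refine lintegral_mono_ae ?_
        filter_upwards [Measure.ae_ne volume τ] with σ hσ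
        by_cases h0 : σ ∈ Ioo 0 t
        · rw [indicator_of_mem h0]
          have hσT : σ ∈ Ioc 0 T := ⟨h0.1, h0.2.le.trans ht.1.2⟩
          rcases lt_or_gt_of_ne hσ with h1 | h1
          · simp [hzero σ hσT h1.le]
          · rw [indicator_of_mem (show σ ∈ Ioo τ t from ⟨h1, h0.2⟩)]
            calc _ ≤ ENNReal.ofReal ((t - σ) ^ (-(θ / p))) * (S * ENNReal.ofReal (σ ^ (-θ))) := by
                  gcongr
                  exact hWS σ hσT (h0.2.le.trans ht.2)
              _ = _ := by ring
        · simp [indicator_of_notMem h0]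
      have hsing := singular_integral_le (β := θ / p) (θ := θ) (by positivity)
        (div_le_self hθ0.le hp.le) hθ hτ htτ.le ht.2
      have ht0 := ht.1.1
      have htp : ENNReal.ofReal (t ^ θ) = ENNReal.ofReal (t ^ (θ / p)) ^ p := by
        rw [ENNReal.ofReal_rpow_of_nonneg (by positivity) hp0.le, ← Real.rpow_mul ht0.le,
          div_mul_cancel₀ _ hp0.ne']
      calc ENNReal.ofReal (t ^ θ) * W t
          ≤ ENNReal.ofReal (t ^ (θ / p)) ^ p * (C * (S * ∫⁻ σ in Ioo τ t,
            ENNReal.ofReal ((t - σ) ^ (-(θ / p))) * ENNReal.ofReal (σ ^ (-θ))) ^ p) := by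
            rw [htp]
            gcongr
            exact (hW t ht.1).trans (by gcongr)
        _ = C * (S ^ (p - 1) * S) * (ENNReal.ofReal (t ^ (θ / p)) * ∫⁻ σ in Ioo τ t,
            ENNReal.ofReal ((t - σ) ^ (-(θ / p))) * ENNReal.ofReal (σ ^ (-θ))) ^ p := by
            have hSp : S ^ (p - 1) * S = S ^ p := by
              conv_lhs => rw [← ENNReal.rpow_one S, ← ENNReal.rpow_mul, one_mul]
              rw [← ENNReal.rpow_add_of_nonneg _ _ (by linarith) zero_le_one, sub_add_cancel]
            rw [ENNReal.mul_rpow_of_nonneg _ _ hp0.le, ENNReal.mul_rpow_of_nonneg _ _ hp0.le, hSp]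
            ring
        _ ≤ C * (M ^ (p - 1) * S) *
            ENNReal.ofReal (2 ^ (θ / p) * 2 * (δ ^ (1 - θ) / (1 - θ))) ^ p := by
            gcongr
        _ = _ := by ring
    have hS0 : S = 0 := by
      by_contra hne
      exact absurd hS' (not_le.2 (by
        simpa using (ENNReal.mul_lt_mul_iff_left hne hSt).2 hδC))
    intro t ht htδ
    simpa [hS0] using hWS t ht htδ
  have hall : ∀ n : ℕ, ∀ t ∈ Ioc 0 T, t ≤ n * δ → W t = 0 := by
    intro n
    induction n with
    | zero =>
      intro t ht h
      simp only [Nat.cast_zero, zero_mul] at h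
      exact absurd ht.1 (not_lt.2 h)
    | succ n ih =>
      intro t ht h
      refine step (n * δ) (by positivity) ih t ht ?_
      push_cast at h
      linarith
  intro t ht
  obtain ⟨n, hn⟩ := exists_nat_ge (t / δ)
  exact hall n t ht ((div_le_iff₀ hδ).1 hn)

/-! ### Nonnegativity of regular solutions. -/

section Regular

variable {N : ℕ}

local notation "E" => EuclideanSpace ℝ (Fin N)

lemma measurable_heatKernel_sub_mul {t : ℝ} {f : ℝ → E → ℝ≥0∞}
    (hf : Measurable (Function.uncurry f)) :
    Measurable fun r : E × (ℝ × E) =>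
      ENNReal.ofReal (heatKernel (t - r.2.1) (r.1 - r.2.2)) * f r.2.1 r.2.2 :=
  (measurable_heatKernel_comp (by fun_prop) (by fun_prop)).ennreal_ofReal.mul
    (hf.comp (f := fun r : E × (ℝ × E) => r.2) (by fun_prop))

/-- The `L^1`-`L^(α+1)` smoothing estimate for the Duhamel term. -/
lemma lintegral_duhamel_rpow_le {α : ℝ} (hα : 0 < α) {t : ℝ} {f : ℝ → E → ℝ≥0∞}
    (hf : Measurable (Function.uncurry f)) :
    ∫⁻ x : E, (∫⁻ σ in Ioo 0 t, ∫⁻ y,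
        ENNReal.ofReal (heatKernel (t - σ) (x - y)) * f σ y) ^ (α + 1) ≤
      ENNReal.ofReal ((4 * Real.pi) ^ (-(N * α / 2))) *
        (∫⁻ σ in Ioo 0 t, ENNReal.ofReal ((t - σ) ^ (-(N * α / 2 / (α + 1)))) *
          ∫⁻ y, f σ y) ^ (α + 1) := by
  have hpi := Real.pi_pos
  set β : ℝ := N * α / 2 / (α + 1) with hβ
  set ρ : Measure (ℝ × E) := (volume.restrict (Ioo 0 t)).prod volume with hρ
  have hρmem : ∀ᵐ q ∂ρ, q.1 ∈ Ioo 0 t :=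
    Measure.quasiMeasurePreserving_fst.ae (ae_restrict_mem measurableSet_Ioo)
  have hfm : Measurable fun q : ℝ × E => f q.1 q.2 := hf
  -- The powers of `t-σ` are distributed so that `∫ g^(α+1) dx` is bounded uniformly in `q`. Jensen
  -- with weight `k` on space-time then does the work of Minkowski's inequality.
  set k : ℝ × E → ℝ≥0∞ := fun q => ENNReal.ofReal ((t - q.1) ^ (-β)) * f q.1 q.2 with hk
  set g : E → ℝ × E → ℝ≥0∞ := fun x q =>
    ENNReal.ofReal (heatKernel (t - q.1) (x - q.2)) * ENNReal.ofReal ((t - q.1) ^ β) with hg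
  have hkm : Measurable k := by fun_prop
  have hgm : Measurable fun r : E × (ℝ × E) => g r.1 r.2 :=
    (measurable_heatKernel_comp (by fun_prop) (by fun_prop)).ennreal_ofReal.mul (by fun_prop)
  have hgx : ∀ x, Measurable (g x) := fun x => hgm.comp (f := fun q => (x, q)) (by fun_prop)
  have hgq : ∀ q, Measurable fun x => g x q := fun q =>
    hgm.comp (f := fun x => (x, q)) (by fun_prop)
  have hkint : ∫⁻ q, k q ∂ρ =
      ∫⁻ σ in Ioo 0 t, ENNReal.ofReal ((t - σ) ^ (-β)) * ∫⁻ y, f σ y := by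
    rw [hρ, lintegral_prod _ hkm.aemeasurable]
    refine lintegral_congr fun σ => ?_
    rw [← lintegral_const_mul' _ _ ENNReal.ofReal_ne_top]
  have hinner : ∀ x : E, ∫⁻ σ in Ioo 0 t, ∫⁻ y,
      ENNReal.ofReal (heatKernel (t - σ) (x - y)) * f σ y = ∫⁻ q, k q * g x q ∂ρ := fun x => by
    rw [hρ, lintegral_prod _
      (show Measurable fun q => k q * g x q from hkm.mul (hgx x)).aemeasurable]
    refine setLIntegral_congr_fun measurableSet_Ioo fun σ hσ => ?_
    refine lintegral_congr fun y => ?_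
    have h0 : 0 < t - σ := by linarith [hσ.2]
    have h1 : ENNReal.ofReal ((t - σ) ^ (-β)) * ENNReal.ofReal ((t - σ) ^ β) = 1 := by
      rw [← ENNReal.ofReal_mul (by positivity), ← Real.rpow_add h0]
      simp
    calc _ = ENNReal.ofReal (heatKernel (t - σ) (x - y)) * f σ y *
          (ENNReal.ofReal ((t - σ) ^ (-β)) * ENNReal.ofReal ((t - σ) ^ β)) := by rw [h1, mul_one]
      _ = _ := by simp only [hk, hg]; ring
  have hgint : ∀ᵐ q ∂ρ, ∫⁻ x, g x q ^ (α + 1) ≤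
      ENNReal.ofReal ((4 * Real.pi) ^ (-(N * α / 2))) := by
    filter_upwards [hρmem] with q hq
    have h0 : 0 < t - q.1 := by linarith [hq.2]
    have hmx : Measurable fun x : E => ENNReal.ofReal (heatKernel (t - q.1) (x - q.2)) :=
      (measurable_heatKernel_comp (by fun_prop) (by fun_prop)).ennreal_ofReal
    -- `K^(α+1) ≤ (sup K)^α K` and `K` has mass one; the time powers cancel since `β(α+1) = Nα/2`.
    calc ∫⁻ x, g x q ^ (α + 1)
        ≤ ∫⁻ x, ENNReal.ofReal (((4 * Real.pi * (t - q.1)) ^ (-((N : ℝ) / 2))) ^ α) *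
            ENNReal.ofReal (((t - q.1) ^ β) ^ (α + 1)) *
            ENNReal.ofReal (heatKernel (t - q.1) (x - q.2)) := by
          refine lintegral_mono fun x => ?_
          have hK := heatKernel_nonneg h0.le (x - q.2)
          simp only [hg]
          rw [ENNReal.mul_rpow_of_nonneg _ _ (by linarith),
            ENNReal.ofReal_rpow_of_nonneg hK (by linarith),
            ENNReal.ofReal_rpow_of_nonneg (by positivity) (by linarith),
            Real.rpow_add_one' hK (by linarith), ENNReal.ofReal_mul (by positivity), mul_right_comm]
          gcongr
          exact heatKernel_le h0 _
      _ = ENNReal.ofReal ((4 * Real.pi) ^ (-(N * α / 2))) := by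
          rw [lintegral_const_mul _ hmx, lintegral_heatKernel_sub_right h0, mul_one,
            ← ENNReal.ofReal_mul (by positivity), ← Real.rpow_mul (by positivity),
            ← Real.rpow_mul h0.le, Real.mul_rpow (by positivity) h0.le, mul_assoc,
            ← Real.rpow_add h0]
          have e1 : -((N : ℝ) / 2) * α = -(N * α / 2) := by ring
          have e2 : β * (α + 1) = N * α / 2 := by rw [hβ]; field_simp
          rw [e1, e2]
          simp
  simp_rw [hinner]
  calc ∫⁻ x : E, (∫⁻ q, k q * g x q ∂ρ) ^ (α + 1)
      ≤ ∫⁻ x : E, (∫⁻ q, k q ∂ρ) ^ α * ∫⁻ q, k q * g x q ^ (α + 1) ∂ρ := by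
        refine lintegral_mono fun x => ?_
        have := lintegral_mul_rpow_le (ν := ρ) (p := α + 1) (by linarith) hkm (hgx x)
        simpa using this
    _ = (∫⁻ q, k q ∂ρ) ^ α * ∫⁻ q, k q * (∫⁻ x : E, g x q ^ (α + 1)) ∂ρ := by
        have hm : Measurable fun r : E × (ℝ × E) => k r.2 * g r.1 r.2 ^ (α + 1) :=
          (hkm.comp measurable_snd).mul (hgm.pow_const _)
        rw [lintegral_const_mul _ hm.lintegral_prod_right',
          lintegral_lintegral_swap hm.aemeasurable]
        congr 1
        refine lintegral_congr fun q => ?_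
        exact lintegral_const_mul (k q) ((hgq q).pow_const (α + 1))
    _ ≤ (∫⁻ q, k q ∂ρ) ^ α * ∫⁻ q, k q * ENNReal.ofReal ((4 * Real.pi) ^ (-(N * α / 2))) ∂ρ := by
        refine mul_le_mul' le_rfl (lintegral_mono_ae ?_)
        filter_upwards [hgint] with q hq
        gcongr
    _ = _ := by
        rw [lintegral_mul_const _ hkm, hkint, ENNReal.rpow_add_of_nonneg _ _ hα.le zero_le_one,
          ENNReal.rpow_one]
        ring

lemma ofReal_abs_rpow_mul {α : ℝ} (hα : 0 < α) (r : ℝ) :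
    ENNReal.ofReal (|r| ^ α * r) = ENNReal.ofReal r ^ (α + 1) := by
  rcases le_or_gt 0 r with hr | hr
  · rw [abs_of_nonneg hr, ENNReal.ofReal_rpow_of_nonneg hr (by linarith),
      Real.rpow_add_one' hr (by linarith)]
  · rw [ENNReal.ofReal_of_nonpos hr.le, ENNReal.zero_rpow_of_pos (by linarith),
      ENNReal.ofReal_of_nonpos (mul_nonpos_of_nonneg_of_nonpos (by positivity) hr.le)]

lemma enorm_abs_rpow_mul {α : ℝ} (hα : 0 < α) (r : ℝ) :
    ‖|r| ^ α * r‖ₑ = ‖r‖ₑ ^ (α + 1) := by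
  rw [Real.enorm_eq_ofReal_abs, Real.enorm_eq_ofReal_abs, abs_mul,
    abs_of_nonneg (Real.rpow_nonneg (abs_nonneg r) α), ← ofReal_abs_rpow_mul hα, abs_abs]

/-- The Duhamel term of a sign-changing function, split into positive and negative parts. -/
lemma integral_duhamel_eq_sub {α : ℝ} (hα : 0 < α) {t : ℝ} {x : E} {v : ℝ → E → ℝ}
    (hv : Measurable (Function.uncurry v))
    (hfin : ∫⁻ σ in Ioo 0 t, ∫⁻ y,
      ENNReal.ofReal (heatKernel (t - σ) (x - y)) * ‖v σ y‖ₑ ^ (α + 1) < ⊤) :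
    ∫ σ in Ioo 0 t, ∫ y, heatKernel (t - σ) (x - y) * (|v σ y| ^ α * v σ y) =
      (∫⁻ σ in Ioo 0 t, ∫⁻ y, ENNReal.ofReal (heatKernel (t - σ) (x - y)) *
        ENNReal.ofReal (v σ y) ^ (α + 1)).toReal -
      (∫⁻ σ in Ioo 0 t, ∫⁻ y, ENNReal.ofReal (heatKernel (t - σ) (x - y)) *
        ENNReal.ofReal (-v σ y) ^ (α + 1)).toReal := by
  have hv' : Measurable fun q : ℝ × E => v q.1 q.2 := hv
  have hK : Measurable fun q : ℝ × E => heatKernel (t - q.1) (x - q.2) :=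
    measurable_heatKernel_comp (by fun_prop) (by fun_prop)
  set G : ℝ × E → ℝ := fun q => heatKernel (t - q.1) (x - q.2) * (|v q.1 q.2| ^ α * v q.1 q.2)
    with hG
  have hGm : Measurable G := by fun_prop
  have hnn : ∀ σ ∈ Ioo 0 t, ∀ y : E, 0 ≤ heatKernel (t - σ) (x - y) := fun σ hσ y =>
    heatKernel_nonneg (by linarith [hσ.2]) _
  have hGi : Integrable G ((volume.restrict (Ioo 0 t)).prod volume) := by
    refine ⟨hGm.aestronglyMeasurable, ?_⟩
    rw [hasFiniteIntegral_iff_enorm, lintegral_prod _ hGm.enorm.aemeasurable]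
    refine lt_of_eq_of_lt (setLIntegral_congr_fun measurableSet_Ioo fun σ hσ => ?_) hfin
    refine lintegral_congr fun y => ?_
    rw [hG, enorm_mul, enorm_abs_rpow_mul hα, Real.enorm_of_nonneg (hnn σ hσ y)]
  rw [← integral_prod _ hGi, integral_eq_lintegral_pos_part_sub_lintegral_neg_part hGi,
    lintegral_prod _ (by fun_prop), lintegral_prod _ (by fun_prop)]
  congr 2
  · refine setLIntegral_congr_fun measurableSet_Ioo fun σ hσ => ?_
    refine lintegral_congr fun y => ?_
    rw [hG, ENNReal.ofReal_mul (hnn σ hσ y), ofReal_abs_rpow_mul hα]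
  · refine setLIntegral_congr_fun measurableSet_Ioo fun σ hσ => ?_
    refine lintegral_congr fun y => ?_
    rw [hG, ← mul_neg, ← mul_neg, ENNReal.ofReal_mul (hnn σ hσ y), ← ofReal_abs_rpow_mul hα,
      abs_neg]

lemma ofReal_integral_heatKernel {t : ℝ} (ht : 0 < t) (x : E) (μ : Measure E)
    [IsFiniteMeasure μ] : ENNReal.ofReal (∫ y, heatKernel t (x - y) ∂μ) =
      ∫⁻ y, ENNReal.ofReal (heatKernel t (x - y)) ∂μ := by
  rw [ofReal_integral_eq_lintegral_ofReal]
  · refine Integrable.of_bound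
      (measurable_heatKernel_comp (by fun_prop) (by fun_prop)).aestronglyMeasurable
      ((4 * Real.pi * t) ^ (-((N : ℝ) / 2))) (.of_forall fun y => ?_)
    rw [Real.norm_of_nonneg (heatKernel_nonneg ht.le _)]
    exact heatKernel_le ht _
  · exact .of_forall fun y => heatKernel_nonneg ht.le _

/-- A regular solution with a positive initial measure is nonnegative, hence its measurable
representative solves the equation in `[0,∞]`. -/
theorem IsRegularSolution.heat_le (hN : 1 ≤ N) {α : ℝ} (hα : 0 < α) (hαN : α < 2 / (N : ℝ))
    {μ : Measure E} [IsFiniteMeasure μ] {T : ℝ} {u : ℝ → E → ℝ}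
    (hu : IsRegularSolution α μ T u) :
    ∀ᵐ t ∂(volume.restrict (Ioo 0 T)), ∀ᵐ x,
      ∫⁻ y, ENNReal.ofReal (heatKernel t (x - y)) ∂μ ≤ ENNReal.ofReal ((α * t) ^ (-(1 / α))) := by
  have hN0 : (0 : ℝ) < N := by exact_mod_cast hN
  have hp0 : 0 < α + 1 := by linarith
  -- The exponent of the a priori bound raised to the power `α+1`; `θ < 1`, that is `α < 2/N`, makes
  -- `σ^(-θ)` integrable at `0`.
  set θ : ℝ := N * α / 2 with hθ
  have hθ0 : 0 < θ := by positivity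
  have hθ1 : θ < 1 := by
    rw [lt_div_iff₀ hN0] at hαN
    rw [hθ]; linarith
  obtain ⟨v', hv'm, hv'⟩ := hu.aemeasurable
  set v : ℝ → E → ℝ := fun t x => v' (t, x) with hv
  have hvm : Measurable (Function.uncurry v) := hv'm
  have huv : ∀ᵐ t ∂(volume.restrict (Ioc 0 T)), ∀ᵐ x, u t x = v t x :=
    ae_ae_of_ae_restrict_prod_univ hv'
  have huvt : ∀ t ∈ Ioc 0 T, ∀ᵐ σ ∂(volume.restrict (Ioo 0 t)), ∀ᵐ x, u σ x = v σ x := fun t ht =>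
    ae_restrict_of_ae_restrict_of_subset
      (show Ioo 0 t ⊆ Ioc 0 T from fun σ hσ => ⟨hσ.1, hσ.2.le.trans ht.2⟩) huv
  obtain ⟨M₀, hM₀⟩ := hu.bounded
  set M : ℝ≥0∞ := ENNReal.ofReal M₀ ^ (α + 1) with hMdef
  have hMtop : M ≠ ⊤ := ENNReal.rpow_ne_top_of_nonneg hp0.le ENNReal.ofReal_ne_top
  have hbound : ∀ t ∈ Ioc 0 T, ENNReal.ofReal (t ^ θ) * ∫⁻ y, ‖u t y‖ₑ ^ (α + 1) ≤ M := by
    intro t ht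
    have ht0 := ht.1
    have h1 := ENNReal.rpow_le_rpow (hM₀ t ht) hp0.le
    rw [ENNReal.mul_rpow_of_nonneg _ _ hp0.le, ENNReal.ofReal_rpow_of_nonneg (by positivity) hp0.le,
      ← Real.rpow_mul ht0.le, eLpNorm_eq_lintegral_rpow_enorm_toReal (by simpa using hp0)
        ENNReal.ofReal_ne_top, ENNReal.toReal_ofReal hp0.le, ← ENNReal.rpow_mul,
      one_div_mul_cancel hp0.ne', ENNReal.rpow_one] at h1
    have e : (N : ℝ) / 2 * (1 - 1 / (α + 1)) * (α + 1) = θ := by rw [hθ]; field_simp; ring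
    rwa [e] at h1
  have hC : ENNReal.ofReal ((4 * Real.pi) ^ (-θ)) ≠ ⊤ := ENNReal.ofReal_ne_top
  have hpow : ∀ {w : ℝ → E → ℝ≥0∞}, Measurable (Function.uncurry w) →
      Measurable (Function.uncurry fun σ y => w σ y ^ (α + 1)) := fun hw => hw.pow_const _
  have hnorm_m : Measurable (Function.uncurry fun σ y => ‖v σ y‖ₑ) := hvm.enorm
  have hneg_m : Measurable (Function.uncurry fun σ y => ENNReal.ofReal (-v σ y)) :=
    hvm.neg.ennreal_ofReal
  have hpos_m : Measurable (Function.uncurry fun σ y => ENNReal.ofReal (v σ y)) :=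
    hvm.ennreal_ofReal
  -- The a priori bound and the smoothing estimate put the Duhamel term of `|v|` in `L^(α+1)`. Being
  -- finite a.e., it may be split into positive and negative parts.
  have hfin : ∀ t ∈ Ioc 0 T, ∀ᵐ x : E, ∫⁻ σ in Ioo 0 t, ∫⁻ y,
      ENNReal.ofReal (heatKernel (t - σ) (x - y)) * ‖v σ y‖ₑ ^ (α + 1) < ⊤ := by
    intro t ht
    have ht0 := ht.1
    have hsmall := lintegral_duhamel_rpow_le hα (t := t) (hpow hnorm_m)
    have hI : ∫⁻ σ in Ioo 0 t, ENNReal.ofReal ((t - σ) ^ (-(θ / (α + 1)))) *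
        ∫⁻ y, ‖v σ y‖ₑ ^ (α + 1) < ⊤ := by
      have hs := singular_integral_le (β := θ / (α + 1)) (θ := θ) (τ := 0) (t := t) (δ := t)
        (by positivity) (div_le_self hθ0.le (by linarith)) hθ1 le_rfl ht0.le (by simp)
      calc _ ≤ ∫⁻ σ in Ioo 0 t, M * (ENNReal.ofReal ((t - σ) ^ (-(θ / (α + 1)))) *
            ENNReal.ofReal (σ ^ (-θ))) := by
            refine lintegral_mono_ae ?_
            filter_upwards [huvt t ht, ae_restrict_mem measurableSet_Ioo] with σ h1 h2
            have e : ∫⁻ y, ‖v σ y‖ₑ ^ (α + 1) = ∫⁻ y, ‖u σ y‖ₑ ^ (α + 1) :=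
              lintegral_congr_ae (by filter_upwards [h1] with y hy; rw [hy])
            have h3 : ∫⁻ y, ‖u σ y‖ₑ ^ (α + 1) ≤ M * ENNReal.ofReal (σ ^ (-θ)) := by
              calc ∫⁻ y, ‖u σ y‖ₑ ^ (α + 1) = ENNReal.ofReal (σ ^ θ) *
                    (∫⁻ y, ‖u σ y‖ₑ ^ (α + 1)) * ENNReal.ofReal (σ ^ (-θ)) := by
                    rw [mul_right_comm, ← ENNReal.ofReal_mul (Real.rpow_nonneg h2.1.le _),
                      ← Real.rpow_add h2.1]
                    simp
                _ ≤ _ := by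
                    gcongr
                    exact hbound σ ⟨h2.1, h2.2.le.trans ht.2⟩
            rw [e, mul_left_comm]
            gcongr
        _ < ⊤ := by
            rw [lintegral_const_mul' _ _ hMtop]
            refine ENNReal.mul_lt_top hMtop.lt_top ?_
            refine ENNReal.lt_top_of_mul_ne_top_right (hs.trans_lt ENNReal.ofReal_lt_top).ne ?_
            simpa using Real.rpow_pos_of_pos ht0 _
    have hlt := hsmall.trans_lt (ENNReal.mul_lt_top hC.lt_top
      (ENNReal.rpow_lt_top_of_nonneg hp0.le hI.ne))
    have hm : Measurable fun x : E => ∫⁻ σ in Ioo 0 t, ∫⁻ y,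
        ENNReal.ofReal (heatKernel (t - σ) (x - y)) * ‖v σ y‖ₑ ^ (α + 1) := by
      have h1 : Measurable fun r : (E × ℝ) × E =>
          ENNReal.ofReal (heatKernel (t - r.1.2) (r.1.1 - r.2)) * ‖v r.1.2 r.2‖ₑ ^ (α + 1) :=
        (measurable_heatKernel_sub_mul (hpow hnorm_m)).comp
          (f := fun r : (E × ℝ) × E => (r.1.1, (r.1.2, r.2))) (by fun_prop)
      exact h1.lintegral_prod_right'.lintegral_prod_right'
    filter_upwards [ae_lt_top (hm.pow_const _) hlt.ne] with x hx
    exact (ENNReal.rpow_lt_top_iff_of_pos hp0).1 hx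
  have heq : ∀ t ∈ Ioc 0 T, ∀ᵐ x : E, u t x = (∫ y, heatKernel t (x - y) ∂μ) +
      ((∫⁻ σ in Ioo 0 t, ∫⁻ y, ENNReal.ofReal (heatKernel (t - σ) (x - y)) *
        ENNReal.ofReal (v σ y) ^ (α + 1)).toReal -
      (∫⁻ σ in Ioo 0 t, ∫⁻ y, ENNReal.ofReal (heatKernel (t - σ) (x - y)) *
        ENNReal.ofReal (-v σ y) ^ (α + 1)).toReal) := by
    intro t ht
    filter_upwards [hu.equation t ht, hfin t ht] with x hx hxf
    rw [hx, ← integral_duhamel_eq_sub hα hvm hxf]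
    congr 1
    refine integral_congr_ae ?_
    filter_upwards [huvt t ht] with σ hσ
    refine integral_congr_ae ?_
    filter_upwards [hσ] with y hy
    rw [hy]
  have hheat0 : ∀ t ∈ Ioc 0 T, ∀ x : E, 0 ≤ ∫ y, heatKernel t (x - y) ∂μ := fun t ht x =>
    integral_nonneg fun y => heatKernel_nonneg ht.1.le _
  set W : ℝ → ℝ≥0∞ := fun t => ∫⁻ y, ENNReal.ofReal (-u t y) ^ (α + 1) with hWdef
  have hWv : ∀ t ∈ Ioc 0 T, ∀ᵐ σ ∂(volume.restrict (Ioo 0 t)),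
      W σ = ∫⁻ y, ENNReal.ofReal (-v σ y) ^ (α + 1) := by
    intro t ht
    filter_upwards [huvt t ht] with σ hσ
    exact lintegral_congr_ae (by filter_upwards [hσ] with y hy; rw [hy])
  have hneg_le : ∀ r : ℝ, ENNReal.ofReal (-r) ≤ ‖r‖ₑ := fun r => by
    rw [Real.enorm_eq_ofReal_abs]
    exact ENNReal.ofReal_le_ofReal (neg_le_abs r)
  have hW0 : ∀ t ∈ Ioc 0 T, W t = 0 := by
    refine eq_zero_of_singular_inequality (p := α + 1) (by linarith) hθ0 hθ1 hC hMtop ?_ ?_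
    · intro t ht
      refine le_trans ?_ (hbound t ht)
      change _ * ∫⁻ y, ENNReal.ofReal (-u t y) ^ (α + 1) ≤ _
      gcongr
      exact hneg_le _
    · intro t ht
      -- The heat term and the positive Duhamel part are nonnegative, so `-u` is at most the Duhamel
      -- term of the negative part.
      calc W t ≤ ∫⁻ x : E, (∫⁻ σ in Ioo 0 t, ∫⁻ y,
              ENNReal.ofReal (heatKernel (t - σ) (x - y)) *
                ENNReal.ofReal (-v σ y) ^ (α + 1)) ^ (α + 1) := by
            refine lintegral_mono_ae ?_
            filter_upwards [heq t ht] with x hx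
            gcongr
            rw [hx]
            refine ENNReal.ofReal_le_of_le_toReal ?_
            have h1 := hheat0 t ht x
            have h2 : 0 ≤ (∫⁻ σ in Ioo 0 t, ∫⁻ y, ENNReal.ofReal (heatKernel (t - σ) (x - y)) *
              ENNReal.ofReal (v σ y) ^ (α + 1)).toReal := ENNReal.toReal_nonneg
            linarith
        _ ≤ _ := lintegral_duhamel_rpow_le hα (hpow hneg_m)
        _ = _ := by
            congr 2
            refine lintegral_congr_ae ?_
            filter_upwards [hWv t ht] with σ hσ
            rw [hσ]
  have hsol : ∀ t ∈ Ioc 0 T, ∀ᵐ x : E,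
      duhamel α μ (fun σ y => ENNReal.ofReal (v σ y)) t x = ENNReal.ofReal (u t x) := by
    intro t ht
    filter_upwards [heq t ht, hfin t ht] with x hx hxf
    have hQ : ∫⁻ σ in Ioo 0 t, ∫⁻ y, ENNReal.ofReal (heatKernel (t - σ) (x - y)) *
        ENNReal.ofReal (-v σ y) ^ (α + 1) = 0 := by
      rw [← lintegral_zero (μ := volume.restrict (Ioo 0 t))]
      refine lintegral_congr_ae ?_
      filter_upwards [hWv t ht, ae_restrict_mem measurableSet_Ioo] with σ hσ hσt
      rw [hW0 σ ⟨hσt.1, hσt.2.le.trans ht.2⟩, eq_comm, lintegral_eq_zero_iff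
        (show Measurable fun y => ENNReal.ofReal (-v σ y) ^ (α + 1) from
          (hneg_m.comp (f := fun y => (σ, y)) (by fun_prop)).pow_const _)] at hσ
      rw [← lintegral_zero (μ := (volume : Measure E))]
      refine lintegral_congr_ae ?_
      filter_upwards [hσ] with y hy
      simp only [Pi.zero_apply] at hy
      rw [hy, mul_zero]
    rw [hQ, ENNReal.toReal_zero, sub_zero] at hx
    rw [hx, ENNReal.ofReal_add (hheat0 t ht x) ENNReal.toReal_nonneg,
      ofReal_integral_heatKernel ht.1, ENNReal.ofReal_toReal]
    · rfl
    · refine (lt_of_le_of_lt ?_ hxf).ne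
      gcongr with σ y
      rw [Real.enorm_eq_ofReal_abs]
      exact ENNReal.ofReal_le_ofReal (le_abs_self _)
  refine heat_le_of_supersolution hα μ hpos_m ?_
    (.of_forall fun t => .of_forall fun x => ENNReal.ofReal_lt_top)
  filter_upwards [ae_restrict_of_ae_restrict_of_subset Ioo_subset_Ioc_self huv,
    ae_restrict_mem measurableSet_Ioo] with t h1 ht
  filter_upwards [h1, hsol t ⟨ht.1, ht.2.le⟩] with x hx hx'
  rw [hx', hx]

end Regular

/-! ### From the pointwise bound to the life span. -/

section LifeSpan

variable {N : ℕ}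

local notation "E" => EuclideanSpace ℝ (Fin N)

/-- A lower bound for the Gaussian averages of `m` around the points of the unit ball. -/
noncomputable def gaussianMass (m : Measure E) (t : ℝ) : ℝ :=
  ∫ y, Real.exp (-(‖y‖ + 1) ^ 2 / (4 * t)) ∂m

lemma gaussianMass_integrand_le_one {t : ℝ} (ht : 0 < t) (y : E) :
    Real.exp (-(‖y‖ + 1) ^ 2 / (4 * t)) ≤ 1 :=
  Real.exp_le_one_iff.2 (div_nonpos_of_nonpos_of_nonneg (by simpa using sq_nonneg (‖y‖ + 1))
    (by positivity))

lemma integrable_gaussianMass (m : Measure E) [IsFiniteMeasure m] {t : ℝ} (ht : 0 < t) :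
    Integrable (fun y => Real.exp (-(‖y‖ + 1) ^ 2 / (4 * t))) m :=
  Integrable.of_bound (by fun_prop) 1 (.of_forall fun y => by
    rw [Real.norm_of_nonneg (Real.exp_pos _).le]
    exact gaussianMass_integrand_le_one ht y)

lemma tendsto_gaussianMass (m : Measure E) [IsFiniteMeasure m] :
    Tendsto (gaussianMass m) atTop (𝓝 (m.real univ)) := by
  have h : ∫ _ : E, (1 : ℝ) ∂m = m.real univ := by simp
  rw [← h]
  refine tendsto_integral_filter_of_dominated_convergence (fun _ => 1)
    (.of_forall fun t => by fun_prop) ?_ (integrable_const _) (.of_forall fun y => ?_)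
  · filter_upwards [eventually_gt_atTop 0] with t ht
    refine .of_forall fun y => ?_
    rw [Real.norm_of_nonneg (Real.exp_pos _).le]
    exact gaussianMass_integrand_le_one ht y
  · have h1 : Tendsto (fun t : ℝ => -(‖y‖ + 1) ^ 2 / (4 * t)) atTop (𝓝 0) :=
      tendsto_const_nhds.div_atTop (tendsto_id.const_mul_atTop (by norm_num))
    simpa [Function.comp_def] using (Real.continuous_exp.tendsto 0).comp h1

/-- The almost everywhere bound `e^{tΔ}μ ≤ (α t)^(-1/α)` on `(0,T)`, for `μ = c m`, read off on
the unit ball. -/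
lemma mul_gaussianMass_le {α c : ℝ} (hα : 0 < α) (hc : 0 < c) (m : Measure E) [IsFiniteMeasure m]
    {T t : ℝ} (ht : 0 < t) (htT : t < T) (hγ : 0 ≤ 1 / α - (N : ℝ) / 2)
    (h : ∀ᵐ s ∂(volume.restrict (Ioo 0 T)), ∀ᵐ x : E,
      ∫⁻ y, ENNReal.ofReal (heatKernel s (x - y)) ∂(ENNReal.ofReal c • m) ≤
        ENNReal.ofReal ((α * s) ^ (-(1 / α)))) :
    c * (t ^ (1 / α - (N : ℝ) / 2) * ((4 * Real.pi) ^ (-((N : ℝ) / 2)) * gaussianMass m t)) ≤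
      α ^ (-(1 / α)) := by
  have hpi := Real.pi_pos
  rw [ae_restrict_iff' measurableSet_Ioo] at h
  -- The bound is known only for a.e. time and point, so a good `s ∈ (t,T)` and a good `x` in the
  -- unit ball are picked by density. Monotonicity in time allows the return from `s` to `t`.
  obtain ⟨s, hs, hst⟩ := (Measure.dense_of_ae h).exists_mem_open isOpen_Ioo (nonempty_Ioo.2 htT)
  have hs0 : 0 < s := ht.trans hst.1
  obtain ⟨x, hx, hx1⟩ := (Measure.dense_of_ae (hs ⟨hs0, hst.2⟩)).exists_mem_open
    (Metric.isOpen_ball (x := (0 : E)) (ε := 1)) ⟨0, by simp⟩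
  rw [mem_ball_zero_iff] at hx1
  rw [mem_ofPred_eq] at hx
  have hI : Integrable (fun y => heatKernel s (x - y)) (ENNReal.ofReal c • m) :=
    (Integrable.of_bound (μ := m)
      (measurable_heatKernel_comp (by fun_prop) (by fun_prop)).aestronglyMeasurable
      ((4 * Real.pi * s) ^ (-((N : ℝ) / 2))) (.of_forall fun y => by
        rw [Real.norm_of_nonneg (heatKernel_nonneg hs0.le _)]
        exact heatKernel_le hs0 _)).smul_measure ENNReal.ofReal_ne_top
  rw [← ofReal_integral_eq_lintegral_ofReal hI (.of_forall fun y => heatKernel_nonneg hs0.le _),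
    ENNReal.ofReal_le_ofReal_iff (by positivity), integral_smul_measure,
    ENNReal.toReal_ofReal hc.le, smul_eq_mul] at hx
  have hI' : Integrable (fun y => heatKernel s (x - y)) m :=
    (integrable_smul_measure (by simpa using hc) ENNReal.ofReal_ne_top).1 hI
  have hlow : (4 * Real.pi * s) ^ (-((N : ℝ) / 2)) * gaussianMass m t ≤
      ∫ y, heatKernel s (x - y) ∂m := by
    rw [gaussianMass, ← integral_const_mul]
    refine integral_mono ((integrable_gaussianMass m ht).const_mul _) hI' fun y => ?_
    simp only [heatKernel]
    gcongr ?_ * Real.exp ?_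
    have h1 : ‖x - y‖ ≤ ‖y‖ + 1 := by linarith [norm_sub_le x y]
    rw [neg_div, neg_div, neg_le_neg_iff]
    have := hst.1.le
    gcongr
  have hF : 0 ≤ gaussianMass m t := integral_nonneg fun y => (Real.exp_pos _).le
  have h2 : c * ((4 * Real.pi * s) ^ (-((N : ℝ) / 2)) * gaussianMass m t) ≤
      (α * s) ^ (-(1 / α)) := (mul_le_mul_of_nonneg_left hlow hc.le).trans hx
  calc c * (t ^ (1 / α - (N : ℝ) / 2) * ((4 * Real.pi) ^ (-((N : ℝ) / 2)) * gaussianMass m t))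
      ≤ c * (s ^ (1 / α - (N : ℝ) / 2) *
          ((4 * Real.pi) ^ (-((N : ℝ) / 2)) * gaussianMass m t)) := by
        gcongr
        exact hst.1.le
    _ = s ^ (1 / α) * (c * ((4 * Real.pi * s) ^ (-((N : ℝ) / 2)) * gaussianMass m t)) := by
        rw [Real.mul_rpow (by positivity) hs0.le, sub_eq_add_neg, Real.rpow_add hs0]
        ring
    _ ≤ s ^ (1 / α) * (α * s) ^ (-(1 / α)) := by gcongr
    _ = α ^ (-(1 / α)) := by
        rw [Real.mul_rpow hα.le hs0.le, mul_left_comm, ← Real.rpow_add hs0]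
        simp

/-- Asymptotics of a life span `Θ(c)` which is controlled by `t` as soon as
`c t^γ F(t) > α^(-1/α)`, where `F` converges to a positive limit. -/
lemma lifeSpan_asymptotics {α γ B L : ℝ} (hα : 0 < α) (hγ : 0 < γ) (hB : 0 < B) (hL : 0 < L)
    {F : ℝ → ℝ} (hF : Tendsto F atTop (𝓝 L)) {Θ : ℝ → ℝ≥0∞}
    (hΘ : ∀ c t : ℝ, 0 < c → 0 < t → α ^ (-(1 / α)) < c * (t ^ γ * (B * F t)) →
      Θ c ≤ ENNReal.ofReal t) :
    (∀ c : ℝ, 0 < c → Θ c < ⊤) ∧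
      limsup (fun c : ℝ => ENNReal.ofReal (c ^ γ⁻¹) * Θ c) (𝓝[>] (0 : ℝ)) ≤
        ENNReal.ofReal (1 / (α ^ (1 / α) * B * L) ^ γ⁻¹) := by
  constructor
  · intro c hc
    have h1 : Tendsto (fun t : ℝ => c * (t ^ γ * (B * F t))) atTop atTop :=
      ((tendsto_rpow_atTop hγ).atTop_mul_pos (mul_pos hB hL) (hF.const_mul B)).const_mul_atTop hc
    obtain ⟨t, ht, ht0⟩ :=
      ((h1.eventually_gt_atTop (α ^ (-(1 / α)))).and (eventually_gt_atTop 0)).exists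
    exact (hΘ c t hc ht0 ht).trans_lt ENNReal.ofReal_lt_top
  · set X : ℝ := α ^ (1 / α) * B * L with hX
    have hXpos : 0 < X := by positivity
    refine ENNReal.le_of_forall_pos_le_add fun ε hε _ => ?_
    -- With `t = R c^(-1/γ)` one has `c t^γ = R^γ`, free of `c`, and `t → ∞` as `c → 0`. The
    -- threshold `R^γ B L > α^(-1/α)` amounts to `R > X^(-1/γ)`.
    set R : ℝ := 1 / X ^ γ⁻¹ + ε with hR
    have hκ : 0 < 1 / X ^ γ⁻¹ := by positivity
    have hεr : (0 : ℝ) < ε := hε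
    have hR0 : 0 < R := by positivity
    have hRe : ENNReal.ofReal (1 / X ^ γ⁻¹) + ε = ENNReal.ofReal R := by
      rw [hR, ENNReal.ofReal_add hκ.le hεr.le, ENNReal.ofReal_coe_nnreal]
    have hRX : α ^ (-(1 / α)) < R ^ γ * (B * L) := by
      have h1 : (1 / X ^ γ⁻¹) ^ γ < R ^ γ := Real.rpow_lt_rpow hκ.le (by linarith) hγ
      rw [Real.div_rpow zero_le_one (by positivity), Real.one_rpow, ← Real.rpow_mul hXpos.le,
        inv_mul_cancel₀ hγ.ne', Real.rpow_one, div_lt_iff₀ hXpos, hX] at h1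
      rw [Real.rpow_neg hα.le, inv_lt_iff_one_lt_mul₀ (by positivity)]
      linarith
    have hlim : Tendsto (fun c : ℝ => R * c ^ (-γ⁻¹)) (𝓝[>] 0) atTop :=
      (tendsto_rpow_neg_nhdsGT_zero (by simpa using hγ)).const_mul_atTop hR0
    have hlim2 : Tendsto (fun c : ℝ => R ^ γ * (B * F (R * c ^ (-γ⁻¹)))) (𝓝[>] 0)
        (𝓝 (R ^ γ * (B * L))) := ((hF.comp hlim).const_mul B).const_mul _
    rw [hRe]
    refine limsup_le_of_le (h := ?_)
    filter_upwards [hlim2.eventually (lt_mem_nhds hRX), self_mem_nhdsWithin] with c h1 hc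
    have hc0 : 0 < c := hc
    have h2 : c * ((R * c ^ (-γ⁻¹)) ^ γ * (B * F (R * c ^ (-γ⁻¹)))) =
        R ^ γ * (B * F (R * c ^ (-γ⁻¹))) := by
      rw [Real.mul_rpow hR0.le (by positivity), ← Real.rpow_mul hc0.le, neg_mul,
        inv_mul_cancel₀ hγ.ne', Real.rpow_neg_one]
      field_simp
    have h3 := hΘ c (R * c ^ (-γ⁻¹)) hc0 (by positivity) (by rwa [h2])
    calc _ ≤ ENNReal.ofReal (c ^ γ⁻¹) * ENNReal.ofReal (R * c ^ (-γ⁻¹)) := by gcongr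
      _ = ENNReal.ofReal R := by
        rw [← ENNReal.ofReal_mul (by positivity), mul_left_comm, ← Real.rpow_add hc0]
        simp

end LifeSpan

end NonlinearHeat

theorem theorem1p6 (N : ℕ) (hN : 1 ≤ N) (α : ℝ) (hα : 0 < α) (hαN : α < 2 / (N : ℝ))
    (m : Measure (EuclideanSpace ℝ (Fin N))) [IsFiniteMeasure m] (hm : m ≠ 0) :
    ((∀ c : ℝ, 0 < c → NonlinearHeat.TmaxNonneg α (ENNReal.ofReal c • m) < ⊤) ∧
      limsup (fun c : ℝ => ENNReal.ofReal (c ^ (1 / α - (N : ℝ) / 2)⁻¹) *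
          NonlinearHeat.TmaxNonneg α (ENNReal.ofReal c • m)) (𝓝[>] (0 : ℝ)) ≤
        ENNReal.ofReal (1 / (α ^ (1 / α) * (4 * Real.pi) ^ (-((N : ℝ) / 2)) * m.real univ) ^
          (1 / α - (N : ℝ) / 2)⁻¹)) ∧
    ((∀ c : ℝ, 0 < c → NonlinearHeat.TmaxRegular α (ENNReal.ofReal c • m) < ⊤) ∧
      limsup (fun c : ℝ => ENNReal.ofReal (c ^ (1 / α - (N : ℝ) / 2)⁻¹) *
          NonlinearHeat.TmaxRegular α (ENNReal.ofReal c • m)) (𝓝[>] (0 : ℝ)) ≤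
        ENNReal.ofReal (1 / (α ^ (1 / α) * (4 * Real.pi) ^ (-((N : ℝ) / 2)) * m.real univ) ^
          (1 / α - (N : ℝ) / 2)⁻¹)) := by
  have hN0 : (0 : ℝ) < N := by exact_mod_cast hN
  have hγ : 0 < 1 / α - (N : ℝ) / 2 := by
    rw [lt_div_iff₀ hN0] at hαN
    rw [sub_pos, lt_div_iff₀ hα]
    linarith
  have hB : 0 < (4 * Real.pi) ^ (-((N : ℝ) / 2)) := Real.rpow_pos_of_pos (by positivity) _
  have hL : 0 < m.real univ := by
    rw [Measure.real, ENNReal.toReal_pos_iff]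
    exact ⟨Measure.measure_univ_pos.2 hm, measure_lt_top m _⟩
  constructor
  · refine NonlinearHeat.lifeSpan_asymptotics hα hγ hB hL
      (NonlinearHeat.tendsto_gaussianMass m) fun c t hc ht h => ?_
    refine iSup_le fun T => iSup_le fun _ => iSup_le fun ⟨u, hu⟩ => ?_
    -- A solution living beyond `t` would satisfy the bound at `t`, against the choice of `t`.
    refine ENNReal.ofReal_le_ofReal (le_of_not_gt fun htT => not_le.2 h ?_)
    have := Measure.smul_finite m (ENNReal.ofReal_ne_top (r := c))
    exact NonlinearHeat.mul_gaussianMass_le hα hc m ht htT hγ.le (hu.heat_le hα)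
  · refine NonlinearHeat.lifeSpan_asymptotics hα hγ hB hL
      (NonlinearHeat.tendsto_gaussianMass m) fun c t hc ht h => ?_
    refine iSup_le fun T => iSup_le fun _ => iSup_le fun ⟨u, hu⟩ => ?_
    refine ENNReal.ofReal_le_ofReal (le_of_not_gt fun htT => not_le.2 h ?_)
    have := Measure.smul_finite m (ENNReal.ofReal_ne_top (r := c))
    exact NonlinearHeat.mul_gaussianMass_le hα hc m ht htT hγ.le (hu.heat_le hN hα hαN)
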